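/- Let $n\ge 0$ and let $S^n=\{x\in\mathbb{R}^{n+1}:\|x\|=1\}$ be the unit sphere, a Riemannian submanifold of Euclidean space, with tangent spaces $T_xS^n=x^\perp$ (with the Euclidean inner product), exponential map $\mathrm{Exp}_x\colon T_xS^n\to S^n$, and parallel transport $P_s\colon T_xS^n\to T_{\mathrm{Exp}_x(s)}S^n$ along the geodesic $t\mapsto \mathrm{Exp}_x(ts)$, $t\in[0,1]$. Let $f\colon S^n\to\mathbb{R}$ be twice differentiable, with Riemannian gradient $\mathrm{grad} f$ and Riemannian Hessian $\mathrm{Hess} f$, and let $\hat f_x=f\circ\mathrm{Exp}_x\colon T_xS^n\to\mathbb{R}$ be its pullbacks. Let $L\in\mathbb{R}$ and assume that $f$ has $L$-Lipschitz continuous gradient, that is, $$\|P_s^*\,\mathrm{grad} f(\mathrm{Exp}_x(s))-\mathrm{grad} f(x)\|\le L\|s\|\quad\text{for all } x\in S^n,\ s\in T_xS^n.$$ Then, for all $x\in S^n$, the function $\hat f_x$ is twice differentiable and has $\tfrac52L$-Lipschitz continuous gradient on the whole tangent space: $$\|\nabla\hat f_x(u)-\nabla\hat f_x(v)\|\le \tfrac52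 L\|u-v\|\quad\text{for all } u,v\in T_xS^n.$$ If moreover, for some $\rho\in\mathbb{R}$, $f$ has $\rho$-Lipschitz continuous Hessian, that is, in operator norm, $$\|P_s^*\circ\mathrm{Hess} f(\mathrm{Exp}_x(s))\circ P_s-\mathrm{Hess} f(x)\|\le\rho\|s\|\quad\text{for all } x\in S^n,\ s\in T_xS^n,$$ then, in operator norm, $$\|\nabla^2\hat f_x(s)-\nabla^2\hat f_x(0)\|\le(\rho+3.1\,L)\|s\|\quad\text{for all } x\in S^n,\ s\in T_xS^n.$$ -/

import Mathlib

open scoped Manifold ContDiff RealInnerProductSpace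

noncomputable section

namespace SpherePullback

/-- The ambient Euclidean space `ℝ^{n+1}`. -/
abbrev Amb (n : ℕ) : Type := EuclideanSpace ℝ (Fin (n + 1))

/-- The unit sphere `S^n` of `ℝ^{n+1}`, with Mathlib's smooth structure. -/
abbrev Sph (n : ℕ) : Type := Metric.sphere (0 : Amb n) 1

instance (n : ℕ) : Fact (Module.finrank ℝ (Amb n) = n + 1) :=
  ⟨finrank_euclideanSpace_fin⟩

variable {n : ℕ}

/-- The tangent space of the sphere at `x`, as the subspace `x^⊥` of `ℝ^{n+1}`, with the inner
product of `ℝ^{n+1}` (the sphere is a Riemannian submanifold of Euclidean space). -/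
abbrev Tan (x : Sph n) : Submodule ℝ (Amb n) := (ℝ ∙ (x : Amb n))ᗮ

/-- The orthogonal projection of `ℝ^{n+1}` onto the tangent space at `x`. -/
def proj (x : Sph n) : Amb n →L[ℝ] Tan x := (Tan x).orthogonalProjectionOnto

/-! ### Differentials, gradient, Hessian -/

/-- The identification of the abstract tangent space of the manifold `S^n` with `x^⊥`, by the
differential of the inclusion of the sphere in `ℝ^{n+1}`. -/
def tangentEquiv (x : Sph n) : TangentSpace (𝓡 n) x ≃ₗ[ℝ] Tan x :=
  (LinearEquiv.ofInjective
      (mvfderiv (𝓡 n) (Subtype.val : Sph n → Amb n) x).toLinearMap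
      (injective_mvfderiv_subtypeVal_sphere x)).trans
    (LinearEquiv.ofEq _ _ (range_mvfderiv_subtypeVal x))

theorem coe_tangentEquiv (x : Sph n) (v : TangentSpace (𝓡 n) x) :
    (tangentEquiv x v : Amb n) = mvfderiv (𝓡 n) (Subtype.val : Sph n → Amb n) x v := rfl

/-- The differential at `x` of a map `g` from the sphere to a normed space, as a linear map
on `x^⊥`. -/
def sphDeriv {F : Type*} [NormedAddCommGroup F] [NormedSpace ℝ F] (g : Sph n → F) (x : Sph n) :
    Tan x →L[ℝ] F :=
  LinearMap.toContinuousLinearMap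
    ((mvfderiv (𝓡 n) g x).toLinearMap ∘ₗ (tangentEquiv x).symm.toLinearMap)

theorem sphDeriv_coe (x : Sph n) (s : Tan x) :
    sphDeriv (fun y : Sph n => (y : Amb n)) x s = s := by
  have h := coe_tangentEquiv x ((tangentEquiv x).symm s)
  rw [LinearEquiv.apply_symm_apply] at h
  exact h.symm

/-- The Riemannian gradient: the tangent vector that represents the differential of `f` at `x`. -/
def grad (f : Sph n → ℝ) (x : Sph n) : Tan x :=
  (InnerProductSpace.toDual ℝ (Tan x)).symm (sphDeriv f x)

theorem inner_grad (f : Sph n → ℝ) (x : Sph n) (s : Tan x) :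
    ⟪grad f x, s⟫ = sphDeriv f x s := by
  simp [grad]

/-- `f` is twice differentiable: it is differentiable, and so is its gradient vector field
(seen as a map to `ℝ^{n+1}`). No continuity of the second derivative is asked. -/
structure TwiceDifferentiable (f : Sph n → ℝ) : Prop where
  mdifferentiable : MDifferentiable (𝓡 n) 𝓘(ℝ, ℝ) f
  mdifferentiable_grad :
    MDifferentiable (𝓡 n) 𝓘(ℝ, Amb n) (fun y : Sph n => (grad f y : Amb n))

/-- The Riemannian (Levi-Civita) connection of a Riemannian submanifold of Euclidean space:
`∇_s V` is the tangential part of the derivative of the tangent vector field `V` along `s`. -/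
def connection (V : (y : Sph n) → Tan y) (x : Sph n) : Tan x →L[ℝ] Tan x :=
  proj x ∘L sphDeriv (fun y : Sph n => (V y : Amb n)) x

/-- The Riemannian Hessian, `Hess f(x)[s] = ∇_s grad f`. -/
def hess (f : Sph n → ℝ) (x : Sph n) : Tan x →L[ℝ] Tan x := connection (grad f) x

/-! ### Geodesics, the exponential map, parallel transport -/

/-- The covariant derivative `D_t Z` of a vector field `Z` along a curve `c` on the sphere:
the tangential part of the derivative. -/
def covDerivAlong (c : ℝ → Sph n) (Z : ℝ → Amb n) (t : ℝ) : Tan (c t) :=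
  proj (c t) (deriv Z t)

/-- The velocity of a curve on the sphere. -/
def velocity (c : ℝ → Sph n) (t : ℝ) : Amb n := deriv (fun r => (c r : Amb n)) t

/-- Geodesics: smooth curves with zero intrinsic acceleration. -/
structure IsGeodesic (c : ℝ → Sph n) : Prop where
  smooth : ContDiff ℝ ∞ (fun t => (c t : Amb n))
  acceleration : ∀ t, covDerivAlong c (velocity c) t = 0

/-- Parallel vector fields along a curve: smooth tangent fields with zero covariant derivative. -/
structure IsParallel (c : ℝ → Sph n) (Z : ℝ → Amb n) : Prop where
  smooth : ContDiff ℝ ∞ Z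
  tangent : ∀ t, Z t ∈ Tan (c t)
  covDeriv : ∀ t, covDerivAlong c Z t = 0

theorem inner_coe_self (x : Sph n) : ⟪(x : Amb n), (x : Amb n)⟫ = 1 := by
  have h : ‖(x : Amb n)‖ = 1 := by simp
  rw [real_inner_self_eq_norm_sq, h]; norm_num

theorem inner_coe_tan (x : Sph n) (s : Tan x) : ⟪(x : Amb n), (s : Amb n)⟫ = 0 :=
  Submodule.mem_orthogonal_singleton_iff_inner_right.1 s.2

theorem inner_tan_coe (x : Sph n) (s : Tan x) : ⟪(s : Amb n), (x : Amb n)⟫ = 0 := by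
  rw [real_inner_comm]; exact inner_coe_tan x s

theorem sinc_mul_self (r : ℝ) : Real.sinc r * r = Real.sin r := by
  rcases eq_or_ne r 0 with h | h
  · simp [h]
  · rw [Real.sinc_of_ne_zero h]; field_simp

/-- The point `cos(‖s‖) x + (sin(‖s‖)/‖s‖) s` of `ℝ^{n+1}`. -/
def expAmb (x : Sph n) (s : Tan x) : Amb n :=
  Real.cos ‖s‖ • (x : Amb n) + Real.sinc ‖s‖ • (s : Amb n)

theorem inner_tan_self (x : Sph n) (s : Tan x) : ⟪(s : Amb n), (s : Amb n)⟫ = ‖s‖ ^ 2 := by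
  rw [real_inner_self_eq_norm_sq]; rfl

theorem inner_expAmb_self (x : Sph n) (s : Tan x) : ⟪expAmb x s, expAmb x s⟫ = 1 := by
  simp only [expAmb, inner_add_left, inner_add_right, real_inner_smul_left, real_inner_smul_right,
    inner_coe_self, inner_coe_tan, inner_tan_coe, inner_tan_self]
  have := Real.sin_sq_add_cos_sq ‖s‖
  rw [← sinc_mul_self] at this
  linarith

/-- The exponential map `Exp_x : T_x S^n → S^n` of the sphere, in closed form; by
`isGeodesic_iff_exp` below, `t ↦ Exp_x (t s)` is the unique geodesic that passes through `x`
at time zero with velocity `s`. -/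
def sphExp (x : Sph n) (s : Tan x) : Sph n :=
  ⟨expAmb x s, by
    have h := inner_expAmb_self x s
    rw [real_inner_self_eq_norm_sq] at h
    have h0 := norm_nonneg (expAmb x s)
    simp only [mem_sphere_iff_norm, sub_zero]
    nlinarith⟩

/-- The vector `v - ⟨s, v⟩ ((1 - cos ‖s‖)/‖s‖² s + (sin ‖s‖)/‖s‖ x)` of `ℝ^{n+1}`. -/
def transportAmb (x : Sph n) (s v : Tan x) : Amb n :=
  (v : Amb n) - ⟪s, v⟫ •
    (((1 - Real.cos ‖s‖) / ‖s‖ ^ 2) • (s : Amb n) + Real.sinc ‖s‖ • (x : Amb n))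

theorem transportAmb_mem (x : Sph n) (s v : Tan x) : transportAmb x s v ∈ Tan (sphExp x s) := by
  rw [Submodule.mem_orthogonal_singleton_iff_inner_right]
  change ⟪expAmb x s, transportAmb x s v⟫ = 0
  simp only [expAmb, transportAmb, inner_add_left, inner_add_right, inner_sub_right,
    real_inner_smul_left, real_inner_smul_right,
    inner_coe_self, inner_coe_tan, inner_tan_coe, inner_tan_self]
  have hsv : ⟪(s : Amb n), (v : Amb n)⟫ = ⟪s, v⟫ := rfl
  rw [hsv]
  rcases eq_or_ne s 0 with h | h
  · simp [h]
  · have h2 : ‖s‖ ≠ 0 := norm_ne_zero_iff.2 h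
    rw [Real.sinc_of_ne_zero h2]
    field_simp
    ring

/-- Parallel transport `P_s : T_x S^n → T_{Exp_x(s)} S^n` along the geodesic `t ↦ Exp_x (t s)`
from time `0` to time `1`, in closed form; by `isParallel_iff_transport` below, `t ↦ P_{ts} v` is
the unique parallel vector field along this geodesic with value `v` at time zero. -/
def transport (x : Sph n) (s : Tan x) : Tan x →L[ℝ] Tan (sphExp x s) :=
  LinearMap.toContinuousLinearMap
    { toFun := fun v => ⟨transportAmb x s v, transportAmb_mem x s v⟩
      map_add' := by
        intro v w
        ext1
        simp only [transportAmb, inner_add_right, Submodule.coe_add]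
        module
      map_smul' := by
        intro a v
        ext1
        simp only [transportAmb, real_inner_smul_right, Submodule.coe_smul, RingHom.id_apply]
        module }

theorem coe_transport (x : Sph n) (s v : Tan x) :
    (transport x s v : Amb n) = transportAmb x s v := rfl

theorem proj_eq_zero_iff (y : Sph n) (w : Amb n) :
    proj y w = 0 ↔ ∃ a : ℝ, a • (y : Amb n) = w := by
  rw [proj, Submodule.orthogonalProjectionOnto_eq_zero_iff, Submodule.orthogonal_orthogonal,
    Submodule.mem_span_singleton]

theorem coe_sphExp_smul (x : Sph n) (s : Tan x) (t : ℝ) :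
    (sphExp x (t • s) : Amb n) =
      Real.cos (t * ‖s‖) • (x : Amb n) + (Real.sin (t * ‖s‖) / ‖s‖) • (s : Amb n) := by
  change expAmb x (t • s) = _
  have h1 : Real.cos (|t| * ‖s‖) = Real.cos (t * ‖s‖) := by
    rw [← Real.cos_abs (t * ‖s‖), abs_mul, abs_norm]
  have h2 : Real.sinc (|t| * ‖s‖) = Real.sinc (t * ‖s‖) := by
    rcases abs_choice t with h | h <;> rw [h]
    rw [neg_mul, Real.sinc_neg]
  rw [expAmb, norm_smul, Real.norm_eq_abs, h1, h2, Submodule.coe_smul, smul_smul]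
  rcases eq_or_ne s 0 with h | h
  · simp [h]
  · have hs : ‖s‖ ≠ 0 := norm_ne_zero_iff.2 h
    rw [← sinc_mul_self (t * ‖s‖)]
    congr 2
    field_simp

theorem coe_transport_smul (x : Sph n) (s v : Tan x) (t : ℝ) :
    (transport x (t • s) v : Amb n) = (v : Amb n) - ⟪s, v⟫ •
      (((1 - Real.cos (t * ‖s‖)) / ‖s‖ ^ 2) • (s : Amb n) +
        (Real.sin (t * ‖s‖) / ‖s‖) • (x : Amb n)) := by
  change transportAmb x (t • s) v = _
  have h1 : Real.cos (|t| * ‖s‖) = Real.cos (t * ‖s‖) := by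
    rw [← Real.cos_abs (t * ‖s‖), abs_mul, abs_norm]
  have h2 : Real.sinc (|t| * ‖s‖) = Real.sinc (t * ‖s‖) := by
    rcases abs_choice t with h | h <;> rw [h]
    rw [neg_mul, Real.sinc_neg]
  rw [transportAmb, norm_smul, Real.norm_eq_abs, h1, h2, Submodule.coe_smul,
    real_inner_smul_left, mul_pow, sq_abs]
  rcases eq_or_ne s 0 with h | h
  · simp [h]
  · have hs : ‖s‖ ≠ 0 := norm_ne_zero_iff.2 h
    rcases eq_or_ne t 0 with ht | ht
    · simp [ht]
    rw [← sinc_mul_self (t * ‖s‖)]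
    congr 1
    rw [smul_add, smul_add, smul_smul, smul_smul, smul_smul, smul_smul, smul_smul]
    congr 2 <;> field_simp

theorem hasDerivAt_exp (x : Sph n) (s : Tan x) (t : ℝ) :
    HasDerivAt (fun t : ℝ => (sphExp x (t • s) : Amb n))
      (-(‖s‖ * Real.sin (t * ‖s‖)) • (x : Amb n) + Real.cos (t * ‖s‖) • (s : Amb n)) t := by
  simp only [coe_sphExp_smul]
  have h0 : HasDerivAt (fun t : ℝ => t * ‖s‖) ‖s‖ t := by
    simpa using (hasDerivAt_id t).mul_const ‖s‖
  have h := (h0.cos.smul_const (x : Amb n)).add ((h0.sin.div_const ‖s‖).smul_const (s : Amb n))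
  refine h.congr_deriv ?_
  congr 1
  · congr 1; ring
  · rcases eq_or_ne s 0 with h | h
    · simp [h]
    · have hs : ‖s‖ ≠ 0 := norm_ne_zero_iff.2 h
      congr 1; field_simp

theorem hasDerivAt_exp' (x : Sph n) (s : Tan x) (t : ℝ) :
    HasDerivAt (fun t : ℝ =>
        -(‖s‖ * Real.sin (t * ‖s‖)) • (x : Amb n) + Real.cos (t * ‖s‖) • (s : Amb n))
      (-(‖s‖ ^ 2) • (sphExp x (t • s) : Amb n)) t := by
  rw [coe_sphExp_smul]
  have h0 : HasDerivAt (fun t : ℝ => t * ‖s‖) ‖s‖ t := by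
    simpa using (hasDerivAt_id t).mul_const ‖s‖
  have h := (((h0.sin.const_mul ‖s‖).neg).smul_const (x : Amb n)).add
    (h0.cos.smul_const (s : Amb n))
  refine h.congr_deriv ?_
  rw [smul_add, smul_smul, smul_smul]
  congr 2
  · ring
  · rcases eq_or_ne s 0 with h | h
    · simp [h]
    · have hs : ‖s‖ ≠ 0 := norm_ne_zero_iff.2 h
      field_simp

theorem hasDerivAt_transport (x : Sph n) (s v : Tan x) (t : ℝ) :
    HasDerivAt (fun t : ℝ => (transport x (t • s) v : Amb n))
      (-⟪s, v⟫ • (sphExp x (t • s) : Amb n)) t := by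
  simp only [coe_transport_smul, coe_sphExp_smul]
  have h0 : HasDerivAt (fun t : ℝ => t * ‖s‖) ‖s‖ t := by
    simpa using (hasDerivAt_id t).mul_const ‖s‖
  have h := (((((h0.cos.const_sub 1).div_const (‖s‖ ^ 2)).smul_const (s : Amb n)).add
    ((h0.sin.div_const ‖s‖).smul_const (x : Amb n))).const_smul ⟪s, v⟫).const_sub (v : Amb n)
  refine h.congr_deriv ?_
  rcases eq_or_ne s 0 with h | h
  · simp [h]
  · have hs : ‖s‖ ≠ 0 := norm_ne_zero_iff.2 h
    have h1 : -(-Real.sin (t * ‖s‖) * ‖s‖) / ‖s‖ ^ 2 = Real.sin (t * ‖s‖) / ‖s‖ := by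
      field_simp
    have h2 : Real.cos (t * ‖s‖) * ‖s‖ / ‖s‖ = Real.cos (t * ‖s‖) := by
      field_simp
    rw [h1, h2, neg_smul]
    congr 2
    exact add_comm _ _

theorem isGeodesic_exp (x : Sph n) (s : Tan x) : IsGeodesic (fun t : ℝ => sphExp x (t • s)) where
  smooth := by
    simp only [coe_sphExp_smul]
    have hc : ContDiff ℝ ∞ Real.cos := Real.contDiff_cos
    have hs : ContDiff ℝ ∞ Real.sin := Real.contDiff_sin
    fun_prop
  acceleration := by
    intro t
    rw [covDerivAlong, proj_eq_zero_iff]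
    refine ⟨-(‖s‖ ^ 2), ?_⟩
    have h : velocity (fun t : ℝ => sphExp x (t • s)) = fun t : ℝ =>
        -(‖s‖ * Real.sin (t * ‖s‖)) • (x : Amb n) + Real.cos (t * ‖s‖) • (s : Amb n) := by
      funext r
      exact (hasDerivAt_exp x s r).deriv
    rw [h, (hasDerivAt_exp' x s t).deriv]

/-- `t ↦ Exp_x (t s)` is the unique geodesic through `x` with velocity `s` at time zero. -/
theorem isGeodesic_iff_exp (x : Sph n) (s : Tan x) (c : ℝ → Sph n) :
    (IsGeodesic c ∧ c 0 = x ∧ velocity c 0 = s) ↔ ∀ t, c t = sphExp x (t • s) := by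
  constructor
  · rintro ⟨hc, h0, hv⟩
    have hsm := hc.smooth
    have d1 : ∀ t, HasDerivAt (fun t => (c t : Amb n)) (velocity c t) t := fun t =>
      ((hsm.differentiable (by simp)) t).hasDerivAt
    have hsm' : ContDiff ℝ ∞ (velocity c) := ((contDiff_infty_iff_deriv).1 hsm).2
    have d2 : ∀ t, HasDerivAt (velocity c) (deriv (velocity c) t) t := fun t =>
      ((hsm'.differentiable (by simp)) t).hasDerivAt
    have o1 : ∀ t, ⟪(c t : Amb n), velocity c t⟫ = 0 := by
      intro t
      have h := (d1 t).inner ℝ (d1 t)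
      have h' : HasDerivAt (fun t => ⟪(c t : Amb n), (c t : Amb n)⟫) 0 t := by
        simp only [inner_coe_self]
        exact hasDerivAt_const _ _
      have e := h.unique h'
      rw [real_inner_comm (c t : Amb n) (velocity c t)] at e
      linarith
    have o2 : ∀ t, ⟪(c t : Amb n), deriv (velocity c) t⟫ = - ⟪velocity c t, velocity c t⟫ := by
      intro t
      have h := (d1 t).inner ℝ (d2 t)
      have h' : HasDerivAt (fun t => ⟪(c t : Amb n), velocity c t⟫) 0 t := by
        simp only [o1]
        exact hasDerivAt_const _ _
      have e := h.unique h'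
      linarith
    have o3 : ∀ t, deriv (velocity c) t = -⟪velocity c t, velocity c t⟫ • (c t : Amb n) := by
      intro t
      obtain ⟨a, ha⟩ := (proj_eq_zero_iff _ _).1 (hc.acceleration t)
      have h := o2 t
      rw [← ha, real_inner_smul_right, inner_coe_self, mul_one] at h
      rw [← ha, h]
    have o4 : ∀ t, ⟪velocity c t, velocity c t⟫ = ‖s‖ ^ 2 := by
      intro t
      have hd : ∀ r, HasDerivAt (fun t => ⟪velocity c t, velocity c t⟫) 0 r := by
        intro r
        have h := (d2 r).inner ℝ (d2 r)
        rw [o3 r, real_inner_smul_left, real_inner_smul_right,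
          real_inner_comm (c r : Amb n) (velocity c r), o1 r] at h
        simpa using h
      have e := is_const_of_deriv_eq_zero (fun r => (hd r).differentiableAt)
        (fun r => (hd r).deriv) t 0
      rw [e, hv, inner_tan_self]
    set d : ℝ → Amb n := fun t => (c t : Amb n) - (sphExp x (t • s) : Amb n) with hdd
    set e : ℝ → Amb n := fun t => velocity c t -
      (-(‖s‖ * Real.sin (t * ‖s‖)) • (x : Amb n) + Real.cos (t * ‖s‖) • (s : Amb n)) with hee
    have D1 : ∀ t, HasDerivAt d (e t) t := fun t => (d1 t).sub (hasDerivAt_exp x s t)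
    have D2 : ∀ t, HasDerivAt e (-(‖s‖ ^ 2) • d t) t := by
      intro t
      have h := (d2 t).sub (hasDerivAt_exp' x s t)
      rw [o3 t, o4 t, ← smul_sub] at h
      exact h
    have hd0 : d 0 = 0 := by simp [hdd, h0, expAmb, sphExp]
    have he0 : e 0 = 0 := by simp [hee, hv]
    have hE : ∀ t, ⟪e t, e t⟫ + ‖s‖ ^ 2 * ⟪d t, d t⟫ = 0 := by
      intro t
      have hd : ∀ r, HasDerivAt (fun t => ⟪e t, e t⟫ + ‖s‖ ^ 2 * ⟪d t, d t⟫) 0 r := by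
        intro r
        have h := ((D2 r).inner ℝ (D2 r)).add (((D1 r).inner ℝ (D1 r)).const_mul (‖s‖ ^ 2))
        refine h.congr_deriv ?_
        rw [real_inner_smul_right, real_inner_smul_left, real_inner_comm (d r) (e r)]
        ring
      have h := is_const_of_deriv_eq_zero (fun r => (hd r).differentiableAt)
        (fun r => (hd r).deriv) t 0
      rw [h, hd0, he0]; simp
    have he : ∀ t, e t = 0 := by
      intro t
      have h1 : 0 ≤ ⟪e t, e t⟫ := real_inner_self_nonneg
      have h2 : 0 ≤ ‖s‖ ^ 2 * ⟪d t, d t⟫ := mul_nonneg (sq_nonneg _) real_inner_self_nonneg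
      exact inner_self_eq_zero.1 (le_antisymm (by linarith [hE t]) h1)
    intro t
    have h := is_const_of_deriv_eq_zero (fun r => (D1 r).differentiableAt)
      (fun r => (D1 r).deriv.trans (he r)) t 0
    rw [hd0] at h
    exact Subtype.ext (sub_eq_zero.1 h)
  · intro h
    obtain rfl : c = fun t => sphExp x (t • s) := funext h
    refine ⟨isGeodesic_exp x s, Subtype.ext ?_, ?_⟩
    · simp only [coe_sphExp_smul]; simp
    · rw [velocity, (hasDerivAt_exp x s 0).deriv]; simp

/-- `t ↦ P_{ts} v` is the unique parallel vector field along `t ↦ Exp_x (t s)` with value `v`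
at time zero. -/
theorem isParallel_iff_transport (x : Sph n) (s v : Tan x) (Z : ℝ → Amb n) :
    (IsParallel (fun t : ℝ => sphExp x (t • s)) Z ∧ Z 0 = v) ↔
      ∀ t, Z t = transport x (t • s) v := by
  have hP : IsParallel (fun t : ℝ => sphExp x (t • s))
      (fun t => (transport x (t • s) v : Amb n)) := by
    refine ⟨?_, fun t => (transport x (t • s) v).2, fun t => ?_⟩
    · simp only [coe_transport_smul]
      have hc : ContDiff ℝ ∞ Real.cos := Real.contDiff_cos
      have hs : ContDiff ℝ ∞ Real.sin := Real.contDiff_sin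
      fun_prop
    · rw [covDerivAlong, (hasDerivAt_transport x s v t).deriv, proj_eq_zero_iff]
      exact ⟨_, rfl⟩
  have hP0 : (transport x ((0 : ℝ) • s) v : Amb n) = v := by
    rw [coe_transport_smul]; simp
  constructor
  · rintro ⟨hZ, h0⟩
    set d : ℝ → Amb n := fun t => Z t - (transport x (t • s) v : Amb n) with hdd
    have D : ∀ t, HasDerivAt d
        (deriv Z t - deriv (fun t => (transport x (t • s) v : Amb n)) t) t := fun t =>
      ((hZ.smooth.differentiable (by simp)) t).hasDerivAt.sub
        ((hP.smooth.differentiable (by simp)) t).hasDerivAt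
    have hE : ∀ t, ⟪d t, d t⟫ = 0 := by
      intro t
      have hd : ∀ r, HasDerivAt (fun t => ⟪d t, d t⟫) 0 r := by
        intro r
        have h := (D r).inner ℝ (D r)
        obtain ⟨a, ha⟩ := (proj_eq_zero_iff _ _).1 (hZ.covDeriv r)
        obtain ⟨b, hb⟩ := (proj_eq_zero_iff _ _).1 (hP.covDeriv r)
        have ht : ⟪d r, (sphExp x (r • s) : Amb n)⟫ = 0 :=
          Submodule.mem_orthogonal_singleton_iff_inner_left.1
            ((Tan (sphExp x (r • s))).sub_mem (hZ.tangent r) (hP.tangent r))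
        rw [← ha, ← hb, ← sub_smul, real_inner_smul_left, real_inner_smul_right,
          real_inner_comm (d r), ht] at h
        simpa using h
      have h := is_const_of_deriv_eq_zero (fun r => (hd r).differentiableAt)
        (fun r => (hd r).deriv) t 0
      rw [h]
      simp [hdd, h0, hP0]
    intro t
    exact sub_eq_zero.1 (inner_self_eq_zero.1 (hE t))
  · intro h
    obtain rfl : Z = fun t => (transport x (t • s) v : Amb n) := funext h
    exact ⟨hP, hP0⟩

/-! ### Lipschitz continuity, pullbacks -/

/-- The gradient of `f` is `L`-Lipschitz continuous:
`‖P_s^* grad f(Exp_x(s)) - grad f(x)‖ ≤ L ‖s‖` for all `x` and `s`. -/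
def HasLipschitzGradient (L : ℝ) (f : Sph n → ℝ) : Prop :=
  ∀ (x : Sph n) (s : Tan x),
    ‖ContinuousLinearMap.adjoint (transport x s) (grad f (sphExp x s)) - grad f x‖ ≤ L * ‖s‖

/-- The Hessian of `f` is `ρ`-Lipschitz continuous:
`‖P_s^* ∘ Hess f(Exp_x(s)) ∘ P_s - Hess f(x)‖ ≤ ρ ‖s‖` (operator norm) for all `x` and `s`. -/
def HasLipschitzHessian (ρ : ℝ) (f : Sph n → ℝ) : Prop :=
  ∀ (x : Sph n) (s : Tan x),
    ‖ContinuousLinearMap.adjoint (transport x s) ∘L hess f (sphExp x s) ∘L transport x s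
      - hess f x‖ ≤ ρ * ‖s‖

/-- The pullback `f ∘ Exp_x`, a function on the Euclidean space `T_x S^n`. -/
def pullback (f : Sph n → ℝ) (x : Sph n) : Tan x → ℝ := fun s => f (sphExp x s)

/-- The Hessian of a function on a tangent space: the derivative of its gradient. -/
def euclHess {x : Sph n} (g : Tan x → ℝ) (s : Tan x) : Tan x →L[ℝ] Tan x :=
  fderiv ℝ (gradient g) s

end SpherePullback

end

open scoped Manifold ContDiff RealInnerProductSpace

noncomputable section

namespace SpherePullback

variable {n : ℕ}

/-! ### Elementary inequalities -/

/-! The differential of `Exp_x` at `s` is `T_s = P_s ∘ R_s`: the transport `P_s` is an isometry and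
`R_s` (`radialScaling`) is symmetric, with eigenvalue `1` along `s` and `sinc ‖s‖` across.
Differentiating `f ∘ Exp_x` twice gives (`inner_euclHess_pullback`) `⟪∇²f̂(s) w, v⟫ = ⟪grad f,
D²Exp(s)[v,w]⟫ + ⟪Hess f (T_s w), T_s v⟫`, with `grad f` and `Hess f` taken at `Exp_x(s)`.

Three bounds control the right side. The Hessian of `f` is at most `L` (`abs_inner_hess_le`), and
`T_s` does not increase norms. On a sphere the gradient is itself at most `π/2 * L`
(`norm_grad_le`): the geodesics of length `π` leaving along `grad f` and `-grad f` both end at the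
antipode, so `f` cannot change much to first order. The tangential part of `D²Exp(s)` is explicit
(`inner_expDeriv2`) and has norm at most `3/π` and at most `‖s‖`.

Hence `‖∇²f̂‖ ≤ (3/π)(π/2)L + L = 5/2 L`, and the mean value inequality gives the Lipschitz
gradient. For the Hessian, `∇²f̂(0) = Hess f(x)`; replacing `T_s` by `P_s` in the second term costs
`L‖s‖`, the hypothesis on `Hess f` costs `ρ‖s‖`, and the first term is at most `1.6 L‖s‖`. -/

theorem abs_le_of_abs_deriv_le {h h' B B' : ℝ → ℝ} (hh : ∀ t, HasDerivAt h (h' t) t)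
    (hB : ∀ t, HasDerivAt B (B' t) t) (h0 : h 0 = 0) (B0 : B 0 = 0) {r : ℝ} (hr : 0 ≤ r)
    (bound : ∀ t, 0 ≤ t → |h' t| ≤ B' t) : |h r| ≤ B r :=
  image_norm_le_of_norm_deriv_right_le_deriv_boundary (a := 0) (b := r)
    (fun t _ => (hh t).continuousAt.continuousWithinAt) (fun t _ => (hh t).hasDerivWithinAt)
    (by simp [h0, B0]) hB (fun t ht => bound t ht.1) ⟨hr, le_rfl⟩

theorem hasDerivAt_sin_sub_mul_cos (t : ℝ) :
    HasDerivAt (fun t => Real.sin t - t * Real.cos t) (t * Real.sin t) t := by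
  refine ((Real.hasDerivAt_sin t).sub ((hasDerivAt_id t).mul (Real.hasDerivAt_cos t))).congr_deriv ?_
  simp

theorem abs_sin_le_self {t : ℝ} (ht : 0 ≤ t) : |Real.sin t| ≤ t := by
  simpa [abs_of_nonneg ht] using Real.abs_sin_le_abs (x := t)

theorem abs_sin_sub_mul_cos_le_sq {r : ℝ} (hr : 0 ≤ r) :
    |Real.sin r - r * Real.cos r| ≤ r ^ 2 / 2 := by
  refine abs_le_of_abs_deriv_le (B := fun t => t ^ 2 / 2) (B' := fun t => t)
    hasDerivAt_sin_sub_mul_cos (fun t => ?_) (by simp) (by simp) hr fun t ht => ?_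
  · exact ((hasDerivAt_pow 2 t).div_const 2).congr_deriv (by simp)
  · rw [abs_mul, abs_of_nonneg ht]
    exact mul_le_of_le_one_right ht (Real.abs_sin_le_one t)

theorem abs_sin_sub_mul_cos_le_cube {r : ℝ} (hr : 0 ≤ r) :
    |Real.sin r - r * Real.cos r| ≤ r ^ 3 / 3 := by
  refine abs_le_of_abs_deriv_le (B := fun t => t ^ 3 / 3) (B' := fun t => t ^ 2)
    hasDerivAt_sin_sub_mul_cos (fun t => ?_) (by simp) (by simp) hr fun t ht => ?_
  · exact ((hasDerivAt_pow 3 t).div_const 3).congr_deriv (by simp)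
  · rw [abs_mul, abs_of_nonneg ht, sq]
    exact mul_le_mul_of_nonneg_left (abs_sin_le_self ht) ht

theorem abs_sub_sin_mul_cos_le {r : ℝ} (hr : 0 ≤ r) :
    |r - Real.sin r * Real.cos r| ≤ 2 * r ^ 3 / 3 := by
  refine abs_le_of_abs_deriv_le (h := fun t => t - Real.sin t * Real.cos t)
    (h' := fun t => 2 * Real.sin t ^ 2) (B := fun t => 2 * t ^ 3 / 3)
    (B' := fun t => 2 * t ^ 2) (fun t => ?_) (fun t => ?_) (by simp) (by simp) hr fun t ht => ?_
  · refine ((hasDerivAt_id t).sub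
      ((Real.hasDerivAt_sin t).mul (Real.hasDerivAt_cos t))).congr_deriv ?_
    linear_combination -Real.sin_sq_add_cos_sq t
  · exact (((hasDerivAt_pow 3 t).const_mul 2).div_const 3).congr_deriv (by simp; ring)
  · rw [abs_of_nonneg (by positivity)]
    have := pow_le_pow_left₀ (abs_nonneg _) (abs_sin_le_self ht) 2
    rw [sq_abs] at this
    linarith

theorem sin_mul_cos_le_self {r : ℝ} (hr : 0 ≤ r) : Real.sin r * Real.cos r ≤ r := by
  have h := Real.sin_le (x := 2 * r) (by linarith)
  rw [Real.sin_two_mul] at h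
  linarith

/-- From `sin r cos r = -sin(2r - π)/2` the left side is at most `2r - π/2`, the tangent line of
`2r²/π` at `r = π/2`. -/
theorem sub_sin_mul_cos_le_of_pi_div_two_le {r : ℝ} (hr : Real.pi / 2 ≤ r) :
    r - Real.sin r * Real.cos r ≤ 2 / Real.pi * r ^ 2 := by
  have h := Real.sin_le (x := 2 * r - Real.pi) (by linarith)
  rw [Real.sin_sub_pi, Real.sin_two_mul] at h
  have hpi := Real.pi_pos
  have h2 : 2 * r - Real.pi / 2 ≤ 2 / Real.pi * r ^ 2 := by
    rw [div_mul_eq_mul_div, le_div_iff₀ hpi]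
    nlinarith [sq_nonneg (2 * r - Real.pi)]
  linarith

/-- The two coefficients of the acceleration of `t ↦ Exp_x (s + t w)` at distance `r`. -/
theorem sq_add_sq_coeff_le {r : ℝ} (hr : 0 < r) :
    ((r - Real.sin r * Real.cos r) / r ^ 2) ^ 2 + ((Real.sin r - r * Real.cos r) / r ^ 2) ^ 2
      ≤ (3 / Real.pi) ^ 2 := by
  have hpi := Real.pi_pos
  have hlt := Real.pi_lt_d4
  have hgt := Real.pi_gt_d4
  have h9 : (0.9 : ℝ) ≤ (3 / Real.pi) ^ 2 := by
    rw [div_pow, le_div_iff₀ (by positivity)]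
    nlinarith
  have hp : 0 < r ^ 2 := by positivity
  have c0 : 0 ≤ (r - Real.sin r * Real.cos r) / r ^ 2 :=
    div_nonneg (sub_nonneg.2 (sin_mul_cos_le_self hr.le)) hp.le
  have d1 : ((Real.sin r - r * Real.cos r) / r ^ 2) ^ 2 ≤ (1 / 2) ^ 2 := by
    refine sq_le_sq' ?_ ?_
    · rw [le_div_iff₀ hp]; linarith [(abs_le.1 (abs_sin_sub_mul_cos_le_sq hr.le)).1]
    · rw [div_le_iff₀ hp]; linarith [(abs_le.1 (abs_sin_sub_mul_cos_le_sq hr.le)).2]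
  -- Below `1.25` the Taylor bounds give `5r²/9 < 0.87`; above it, `0.8² + 0.5² = 0.89`. Both stay
  -- under `0.9 < (3/π)²`.
  rcases le_or_gt r 1.25 with h1 | h1
  · have e1 : ((Real.sin r - r * Real.cos r) / r ^ 2) ^ 2 ≤ (r / 3) ^ 2 := by
      refine sq_le_sq' ?_ ?_
      · rw [le_div_iff₀ hp]
        linarith [(abs_le.1 (abs_sin_sub_mul_cos_le_cube hr.le)).1]
      · rw [div_le_iff₀ hp]
        linarith [(abs_le.1 (abs_sin_sub_mul_cos_le_cube hr.le)).2]
    have e2 : ((r - Real.sin r * Real.cos r) / r ^ 2) ≤ 2 * r / 3 := by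
      rw [div_le_iff₀ hp]
      linarith [(abs_le.1 (abs_sub_sin_mul_cos_le hr.le)).2]
    have e3 := pow_le_pow_left₀ c0 e2 2
    nlinarith
  · suffices h : (r - Real.sin r * Real.cos r) / r ^ 2 ≤ 0.8 by
      have e3 := pow_le_pow_left₀ c0 h 2
      norm_num at e3 d1 ⊢
      linarith
    -- Up to `π/2` the product `sin r cos r` is nonnegative and the quotient is at most `1/r < 0.8`;
    -- beyond, it is at most `2/π < 0.8`.
    rcases le_or_gt r (Real.pi / 2) with h2 | h2
    · have hs := Real.sin_nonneg_of_nonneg_of_le_pi hr.le (by linarith)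
      have hc := Real.cos_nonneg_of_neg_pi_div_two_le_of_le (by linarith) h2
      rw [div_le_iff₀ hp]
      nlinarith [mul_nonneg hs hc]
    · have h := sub_sin_mul_cos_le_of_pi_div_two_le h2.le
      rw [div_le_iff₀ hp]
      have : 2 / Real.pi ≤ 0.8 := by rw [div_le_iff₀ hpi]; linarith
      nlinarith

theorem one_sub_sinc_le {r : ℝ} (hr : 0 ≤ r) : 1 - Real.sinc r ≤ r / 2 := by
  rcases hr.eq_or_lt with rfl | h
  · simp
  · have := abs_le_of_abs_deriv_le (h := fun t => t - Real.sin t) (h' := fun t => 1 - Real.cos t)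
      (B := fun t => t ^ 2 / 2) (B' := fun t => t)
      (fun t => (hasDerivAt_id t).sub (Real.hasDerivAt_sin t))
      (fun t => ((hasDerivAt_pow 2 t).div_const 2).congr_deriv (by simp)) (by simp) (by simp) hr
      (fun t ht => by
        rw [abs_of_nonneg (by linarith [Real.cos_le_one t])]
        rcases le_or_gt t 2 with h2 | h2
        · nlinarith [Real.one_sub_sq_div_two_le_cos (x := t)]
        · linarith [Real.neg_one_le_cos t])
    rw [Real.sinc_of_ne_zero h.ne', sub_le_iff_le_add, ← sub_le_iff_le_add', le_div_iff₀ h]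
    have := (abs_le.1 this).2
    nlinarith

/-! ### Radial functions -/

/-- The coefficient `sinc'(r)/r`, with the value `0` at `r = 0`. -/
def sincDerivCoeff (r : ℝ) : ℝ := (Real.cos r - Real.sinc r) / r ^ 2

theorem hasDerivAt_sinc (r : ℝ) : HasDerivAt Real.sinc (sincDerivCoeff r * r) r := by
  rcases eq_or_ne r 0 with rfl | hr
  · rw [mul_zero, hasDerivAt_iff_isLittleO]
    have key : ∀ t : ℝ, |Real.sinc t - 1| ≤ |t| ^ 2 := by
      intro t
      rcases eq_or_ne t 0 with rfl | ht
      · simp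
      have habs : Real.sinc t = Real.sinc |t| := by
        rcases abs_choice t with h | h <;> rw [h]
        rw [Real.sinc_neg]
      have hp := abs_pos.2 ht
      rw [habs, abs_sub_comm, abs_of_nonneg (sub_nonneg.2 (Real.sinc_le_one _)),
        Real.sinc_of_ne_zero hp.ne', sub_le_iff_le_add, ← sub_le_iff_le_add', le_div_iff₀ hp]
      have := Real.sin_gt_sub_cube hp
      nlinarith [pow_pos hp 3]
    have hO : (fun t => Real.sinc t - Real.sinc 0 - (t - 0) • (0 : ℝ)) =O[nhds 0]
        fun t : ℝ => t ^ 2 := by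
      refine Asymptotics.IsBigO.of_bound 1 (Filter.Eventually.of_forall fun t => ?_)
      simpa using key t
    exact hO.trans_isLittleO (by simpa using Asymptotics.isLittleO_pow_id (𝕜 := ℝ) (n := 2) (by norm_num))
  · have h := (Real.hasDerivAt_sin r).div (hasDerivAt_id r) hr
    have he : Real.sinc =ᶠ[nhds r] fun t => Real.sin t / id t := by
      filter_upwards [isOpen_ne.mem_nhds hr] with t ht
      exact Real.sinc_of_ne_zero ht
    refine (h.congr_of_eventuallyEq he).congr_deriv ?_
    rw [sincDerivCoeff, Real.sinc_of_ne_zero hr]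
    simp only [id]
    field_simp

theorem hasDerivAt_cos (r : ℝ) : HasDerivAt Real.cos (-Real.sinc r * r) r := by
  rw [neg_mul, sinc_mul_self]
  exact Real.hasDerivAt_cos r

/-- The point `0` must be excluded: the limit there is `-1/3`, while the assigned value is `0`. -/
theorem hasDerivAt_sincDerivCoeff {r : ℝ} (hr : r ≠ 0) :
    HasDerivAt sincDerivCoeff (-((Real.sinc r + 3 * sincDerivCoeff r) / r ^ 2) * r) r := by
  have h := ((hasDerivAt_cos r).sub (hasDerivAt_sinc r)).div (hasDerivAt_pow 2 r) (by positivity)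
  refine h.congr_deriv ?_
  simp only [sincDerivCoeff, Pi.sub_apply]
  field_simp
  norm_num
  ring

theorem abs_sincDerivCoeff_le {r : ℝ} (hr : 0 ≤ r) : |sincDerivCoeff r| ≤ 1 / 3 := by
  rcases hr.eq_or_lt with rfl | h
  · simp [sincDerivCoeff]
  have h3 : 0 < r ^ 3 := by positivity
  have e : sincDerivCoeff r = -((Real.sin r - r * Real.cos r) / r ^ 3) := by
    rw [sincDerivCoeff, Real.sinc_of_ne_zero h.ne']
    field_simp
    ring
  rw [e, abs_neg, abs_div, abs_of_pos h3, div_le_iff₀ h3]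
  linarith [abs_sin_sub_mul_cos_le_cube hr]

/-- Writing the derivative as `k * ‖s‖` makes the formula hold at `s = 0` too, where the norm is not
differentiable; the value of `k` is then irrelevant. -/
theorem hasFDerivAt_comp_norm {V : Type*} [NormedAddCommGroup V] [InnerProductSpace ℝ V]
    {φ : ℝ → ℝ} {k : ℝ} {s : V} (h : HasDerivAt φ (k * ‖s‖) ‖s‖) :
    HasFDerivAt (fun u : V => φ ‖u‖) (k • innerSL ℝ s) s := by
  rcases eq_or_ne s 0 with rfl | hs
  · have h0 : HasDerivAt φ 0 0 := by simpa using h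
    rw [map_zero, smul_zero, hasFDerivAt_iff_isLittleO_nhds_zero]
    rw [hasDerivAt_iff_isLittleO_nhds_zero] at h0
    have ht : Filter.Tendsto (fun u : V => ‖u‖) (nhds 0) (nhds 0) := tendsto_norm_zero
    have := h0.comp_tendsto ht
    rw [← Asymptotics.isLittleO_norm_right]
    simpa [Function.comp_def] using this
  · have hn : HasFDerivAt (fun u : V => ‖u‖) (‖s‖⁻¹ • innerSL ℝ s) s := by
      have h1 := (hasStrictFDerivAt_norm_sq s).hasFDerivAt.sqrt
        (pow_ne_zero 2 (norm_ne_zero_iff.2 hs))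
      simp only [Real.sqrt_sq (norm_nonneg _)] at h1
      refine h1.congr_fderiv ?_
      ext v
      simp
      ring
    refine (h.comp_hasFDerivAt s hn).congr_fderiv ?_
    rw [smul_smul, mul_assoc, mul_inv_cancel₀ (norm_ne_zero_iff.2 hs), mul_one]

/-! ### The differential of the exponential map -/

/-- The endomorphism of `T_x S^n` that is the identity along `s` and `sinc ‖s‖` across. -/
def radialScaling {x : Sph n} (s : Tan x) : Tan x →L[ℝ] Tan x :=
  Real.sinc ‖s‖ • ContinuousLinearMap.id ℝ (Tan x) +
    ((1 - Real.sinc ‖s‖) / ‖s‖ ^ 2) • (innerSL ℝ s).smulRight s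

theorem radialScaling_apply {x : Sph n} (s v : Tan x) :
    radialScaling s v =
      Real.sinc ‖s‖ • v + ((1 - Real.sinc ‖s‖) / ‖s‖ ^ 2 * ⟪s, v⟫) • s := by
  simp [radialScaling, smul_smul]

theorem inner_radialScaling {x : Sph n} (s v : Tan x) : ⟪s, radialScaling s v⟫ = ⟪s, v⟫ := by
  rw [radialScaling_apply, inner_add_right, real_inner_smul_right, real_inner_smul_right,
    real_inner_self_eq_norm_sq]
  rcases eq_or_ne s 0 with rfl | h
  · simp
  · have := norm_ne_zero_iff.2 h
    field_simp
    ring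

/-- The differential of `Exp_x` at `s`. -/
def expDeriv (x : Sph n) (s : Tan x) : Tan x →L[ℝ] Tan (sphExp x s) :=
  transport x s ∘L radialScaling s

/-- In this form the base point enters only through smooth radial terms, ready for a second
differentiation. -/
theorem coe_expDeriv (x : Sph n) (s v : Tan x) :
    (expDeriv x s v : Amb n) = Real.sinc ‖s‖ • (v : Amb n) +
      (sincDerivCoeff ‖s‖ * ⟪s, v⟫) • (s : Amb n) - (Real.sinc ‖s‖ * ⟪s, v⟫) • (x : Amb n) := by
  rw [expDeriv, ContinuousLinearMap.comp_apply, coe_transport, transportAmb, inner_radialScaling,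
    radialScaling_apply, sincDerivCoeff]
  simp only [Submodule.coe_add, Submodule.coe_smul]
  module

theorem hasFDerivAt_expAmb (x : Sph n) (s : Tan x) :
    HasFDerivAt (expAmb x) ((Tan (sphExp x s)).subtypeL ∘L expDeriv x s) s := by
  have hc := (hasFDerivAt_comp_norm (hasDerivAt_cos ‖s‖)).smul_const (x : Amb n)
  have hs := (hasFDerivAt_comp_norm (hasDerivAt_sinc ‖s‖)).smul (Tan x).subtypeL.hasFDerivAt
  refine (hc.add hs).congr_fderiv ?_
  ext1 v
  simp only [ContinuousLinearMap.comp_apply, Submodule.subtypeL_apply, coe_expDeriv]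
  simp
  module

/-! ### Chain rule through the sphere -/

section Chain

variable {W : Type*} [NormedAddCommGroup W] [NormedSpace ℝ W]

/-- The chart at `f s` is the stereographic projection from `-f s`, whose formula is smooth on an
open set of the ambient space containing `f s`. -/
theorem mdifferentiableAt_of_coe {f : W → Sph n} {s : W}
    (hf : DifferentiableAt ℝ (fun w => (f w : Amb n)) s) :
    MDifferentiableAt 𝓘(ℝ, W) (𝓡 n) f s := by
  rw [mdifferentiableAt_iff_target]
  refine ⟨Topology.IsInducing.subtypeVal.continuousAt_iff.2 hf.continuousAt, ?_⟩
  rw [mdifferentiableAt_iff_differentiableAt]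
  have hmem : (f s : Amb n) ∈ {z : Amb n | innerSL ℝ (((-f s : Sph n)) : Amb n) z ≠ (1 : ℝ)} := by
    simp [coe_neg_sphere]
    norm_num
  have hopen : IsOpen {z : Amb n | innerSL ℝ (((-f s : Sph n)) : Amb n) z ≠ (1 : ℝ)} :=
    isOpen_ne_fun (by fun_prop) continuous_const
  have h1 := ((contDiffOn_stereoToFun (v := (((-f s : Sph n)) : Amb n)) (n := 1)).contDiffAt
    (hopen.mem_nhds hmem)).differentiableAt one_ne_zero
  have h2 := h1.comp s hf
  have h3 := ((OrthonormalBasis.fromOrthogonalSpanSingleton (𝕜 := ℝ)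
        n (ne_zero_of_mem_unit_sphere (-f s))).repr.toContinuousLinearEquiv.differentiableAt).comp s h2
  exact h3

/-- The manifold derivative of `f` is never computed: followed by the inclusion it is the known
ambient derivative, and `tangentEquiv` is the differential of the inclusion. The separate `y` serves
base points such as `sphExp x (0 • s)`, equal to `x` only propositionally. -/
theorem hasFDerivAt_comp_of_coe {F : Type*} [NormedAddCommGroup F] [NormedSpace ℝ F]
    {g : Sph n → F} {f : W → Sph n} {s : W} {y : Sph n} (hy : f s = y)
    (hg : MDifferentiableAt (𝓡 n) 𝓘(ℝ, F) g y) {f' : W →L[ℝ] Tan y}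
    (hf : HasFDerivAt (fun w => (f w : Amb n)) ((Tan y).subtypeL ∘L f') s) :
    HasFDerivAt (fun w => g (f w)) (sphDeriv g y ∘L f') s := by
  subst hy
  have hm := mdifferentiableAt_of_coe hf.differentiableAt
  have hv : MDifferentiableAt (𝓡 n) 𝓘(ℝ, Amb n) (Subtype.val : Sph n → Amb n) (f s) :=
    (contMDiff_coe_sphere (f s)).mdifferentiableAt one_ne_zero
  have hd := mdifferentiableAt_iff_differentiableAt.1 (hg.comp s hm)
  refine hd.hasFDerivAt.congr_fderiv ?_
  ext1 w
  have e1 : fderiv ℝ (g ∘ f) s w =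
      mvfderiv (𝓡 n) g (f s) (mfderiv 𝓘(ℝ, W) (𝓡 n) f s w) := by
    rw [← mfderiv_eq_fderiv]
    exact mfderiv_comp_apply s hg hm w
  have e2 : fderiv ℝ (Subtype.val ∘ f) s w =
      mvfderiv (𝓡 n) (Subtype.val : Sph n → Amb n) (f s) (mfderiv 𝓘(ℝ, W) (𝓡 n) f s w) := by
    rw [← mfderiv_eq_fderiv]
    exact mfderiv_comp_apply s hv hm w
  have e3 : tangentEquiv (f s) (mfderiv 𝓘(ℝ, W) (𝓡 n) f s w) = f' w := by
    ext1
    rw [coe_tangentEquiv, ← e2, show Subtype.val ∘ f = fun w => (f w : Amb n) from rfl, hf.fderiv]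
    rfl
  rw [e1]
  change _ = mvfderiv (𝓡 n) g (f s) ((tangentEquiv (f s)).symm (f' w))
  rw [← e3, LinearEquiv.symm_apply_apply]

end Chain

theorem hasFDerivAt_comp_sphExp {F : Type*} [NormedAddCommGroup F] [NormedSpace ℝ F]
    {g : Sph n → F} (hg : MDifferentiable (𝓡 n) 𝓘(ℝ, F) g) (x : Sph n) (s : Tan x) :
    HasFDerivAt (fun u => g (sphExp x u)) (sphDeriv g (sphExp x s) ∘L expDeriv x s) s :=
  hasFDerivAt_comp_of_coe (f := sphExp x) rfl (hg _) (hasFDerivAt_expAmb x s)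

/-! ### Norms of the transport and of the differential of the exponential map -/

theorem sphExp_zero (x : Sph n) : sphExp x 0 = x := by
  ext1
  simp [sphExp, expAmb]

theorem inner_transport (x : Sph n) (s v w : Tan x) :
    ⟪transport x s v, transport x s w⟫ = ⟪v, w⟫ := by
  change ⟪transportAmb x s v, transportAmb x s w⟫ = _
  have h1 : ∀ a b : Tan x, ⟪(a : Amb n), (b : Amb n)⟫ = ⟪a, b⟫ := fun _ _ => rfl
  rcases eq_or_ne s 0 with rfl | h
  · simp [transportAmb]
  have h2 : ‖s‖ ≠ 0 := norm_ne_zero_iff.2 h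
  simp only [transportAmb, inner_add_left, inner_add_right, inner_sub_left, inner_sub_right,
    real_inner_smul_left, real_inner_smul_right, inner_coe_self, inner_coe_tan, inner_tan_coe, h1,
    real_inner_self_eq_norm_sq s, real_inner_comm s v, Real.sinc_of_ne_zero h2]
  field_simp
  linear_combination ‖s‖ * ⟪s, v⟫ * ⟪s, w⟫ * Real.sin_sq_add_cos_sq ‖s‖

theorem norm_transport (x : Sph n) (s v : Tan x) : ‖transport x s v‖ = ‖v‖ := by
  rw [← sq_eq_sq₀ (norm_nonneg _) (norm_nonneg _), ← real_inner_self_eq_norm_sq, inner_transport,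
    real_inner_self_eq_norm_sq]

/-- The squared norm is a convex combination, with weights `sinc²` and `1 - sinc²`, of `‖v‖²` and
the squared component of `v` along `s`. -/
theorem norm_radialScaling_le {x : Sph n} (s v : Tan x) : ‖radialScaling s v‖ ≤ ‖v‖ := by
  rcases eq_or_ne s 0 with rfl | h
  · simp [radialScaling_apply]
  have h2 : 0 < ‖s‖ := norm_pos_iff.2 h
  rw [← sq_le_sq₀ (norm_nonneg _) (norm_nonneg _), ← real_inner_self_eq_norm_sq]
  simp only [radialScaling_apply, inner_add_left, inner_add_right, real_inner_smul_left,
    real_inner_smul_right, real_inner_self_eq_norm_sq s, real_inner_self_eq_norm_sq v,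
    real_inner_comm s v]
  have h3 : ⟪s, v⟫ ^ 2 / ‖s‖ ^ 2 ≤ ‖v‖ ^ 2 := by
    rw [div_le_iff₀ (by positivity), ← mul_pow, ← sq_abs, mul_comm]
    exact pow_le_pow_left₀ (abs_nonneg _) (abs_real_inner_le_norm s v) 2
  have h4 : Real.sinc ‖s‖ ^ 2 ≤ 1 := (sq_le_one_iff_abs_le_one _).2 (Real.abs_sinc_le_one _)
  refine le_of_eq_of_le (b := Real.sinc ‖s‖ ^ 2 * ‖v‖ ^ 2
    + (1 - Real.sinc ‖s‖ ^ 2) * (⟪s, v⟫ ^ 2 / ‖s‖ ^ 2)) ?_ (by nlinarith)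
  field_simp
  ring

/-- The difference is `-(1 - sinc ‖s‖)` times the orthogonal projection of `v` onto the complement
of `s`. -/
theorem norm_radialScaling_sub_le {x : Sph n} (s v : Tan x) :
    ‖radialScaling s v - v‖ ≤ (1 - Real.sinc ‖s‖) * ‖v‖ := by
  rcases eq_or_ne s 0 with rfl | h
  · simp [radialScaling_apply]
  have h2 : 0 < ‖s‖ := norm_pos_iff.2 h
  have h4 : 0 ≤ 1 - Real.sinc ‖s‖ := sub_nonneg.2 (Real.sinc_le_one _)
  rw [← sq_le_sq₀ (norm_nonneg _) (by positivity), ← real_inner_self_eq_norm_sq]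
  simp only [radialScaling_apply, inner_add_left, inner_add_right, inner_sub_left, inner_sub_right,
    real_inner_smul_left, real_inner_smul_right, real_inner_self_eq_norm_sq s,
    real_inner_self_eq_norm_sq v, real_inner_comm s v]
  refine le_of_eq_of_le (b := (1 - Real.sinc ‖s‖) ^ 2 * (‖v‖ ^ 2 - ⟪s, v⟫ ^ 2 / ‖s‖ ^ 2)) ?_ ?_
  · field_simp
    ring
  · rw [mul_pow]
    gcongr
    have : 0 ≤ ⟪s, v⟫ ^ 2 / ‖s‖ ^ 2 := by positivity
    linarith

theorem norm_expDeriv_le (x : Sph n) (s v : Tan x) : ‖expDeriv x s v‖ ≤ ‖v‖ := by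
  rw [expDeriv, ContinuousLinearMap.comp_apply, norm_transport]
  exact norm_radialScaling_le s v

/-! ### Consequences of the Lipschitz continuity of the gradient -/

variable {f : Sph n → ℝ} {L : ℝ}

theorem HasLipschitzGradient.abs_inner_sub_le (hL : HasLipschitzGradient L f) (x : Sph n)
    (s v : Tan x) :
    |⟪grad f (sphExp x s), transport x s v⟫ - ⟪grad f x, v⟫| ≤ L * ‖s‖ * ‖v‖ := by
  rw [← ContinuousLinearMap.adjoint_inner_left, ← inner_sub_left]
  exact (abs_real_inner_le_norm _ _).trans (mul_le_mul_of_nonneg_right (hL x s) (norm_nonneg _))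

theorem HasLipschitzGradient.nonneg (hL : HasLipschitzGradient L f) {x : Sph n} {s : Tan x}
    (hs : s ≠ 0) : 0 ≤ L :=
  nonneg_of_mul_nonneg_left ((norm_nonneg _).trans (hL x s)) (norm_pos_iff.2 hs)

/-- The velocity of a geodesic is parallel, so at time `t` it is the transport of `s`. -/
theorem hasDerivAt_comp_sphExp_smul {F : Type*} [NormedAddCommGroup F] [NormedSpace ℝ F]
    {g : Sph n → F} (hg : MDifferentiable (𝓡 n) 𝓘(ℝ, F) g) (x : Sph n) (s : Tan x) (t : ℝ) :
    HasDerivAt (fun t : ℝ => g (sphExp x (t • s)))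
      (sphDeriv g (sphExp x (t • s)) (transport x (t • s) s)) t := by
  refine (hasFDerivAt_comp_of_coe (f := fun t : ℝ => sphExp x (t • s)) (y := sphExp x (t • s)) rfl
    (hg _) (f' := ContinuousLinearMap.toSpanSingleton ℝ (transport x (t • s) s)) ?_).hasDerivAt
      |>.congr_deriv (by simp)
  refine (hasDerivAt_exp x s t).hasFDerivAt.congr_fderiv ?_
  ext1
  simp only [ContinuousLinearMap.toSpanSingleton_apply, ContinuousLinearMap.comp_apply,
    Submodule.subtypeL_apply, one_smul, coe_transport_smul]
  rcases eq_or_ne s 0 with rfl | h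
  · simp
  have h2 : ‖s‖ ≠ 0 := norm_ne_zero_iff.2 h
  rw [real_inner_self_eq_norm_sq, smul_add, smul_smul, smul_smul, mul_div_cancel₀ _ (by positivity),
    show ‖s‖ ^ 2 * (Real.sin (t * ‖s‖) / ‖s‖) = ‖s‖ * Real.sin (t * ‖s‖) by field_simp]
  module

theorem HasLipschitzGradient.abs_sub_sub_le (hL : HasLipschitzGradient L f)
    (hf : MDifferentiable (𝓡 n) 𝓘(ℝ, ℝ) f) (x : Sph n) (s : Tan x) :
    |f (sphExp x s) - f x - ⟪grad f x, s⟫| ≤ L * ‖s‖ ^ 2 / 2 := by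
  have h := abs_le_of_abs_deriv_le
    (h := fun t : ℝ => f (sphExp x (t • s)) - f x - t * ⟪grad f x, s⟫)
    (B := fun t => L * ‖s‖ ^ 2 * t ^ 2 / 2) (B' := fun t => L * ‖s‖ ^ 2 * t)
    (fun t => ((hasDerivAt_comp_sphExp_smul hf x s t).sub_const (f x)).sub
      ((hasDerivAt_id t).mul_const ⟪grad f x, s⟫))
    (fun t => (((hasDerivAt_pow 2 t).const_mul _).div_const 2).congr_deriv (by simp; ring))
    (by simp [sphExp_zero]) (by simp) zero_le_one (fun t ht => by
      rw [← inner_grad, one_mul]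
      refine (hL.abs_inner_sub_le x (t • s) s).trans_eq ?_
      rw [norm_smul, Real.norm_of_nonneg ht]
      ring)
  simpa using h

/-- Take `s` along the gradient with length `π`, so that `s` and `-s` reach the same antipode.
Subtracting the two Taylor bounds cancels the values of `f` and leaves `2π‖grad f x‖ ≤ Lπ²`. -/
theorem HasLipschitzGradient.norm_grad_le (hL : HasLipschitzGradient L f) (hL0 : 0 ≤ L)
    (hf : MDifferentiable (𝓡 n) 𝓘(ℝ, ℝ) f) (x : Sph n) : ‖grad f x‖ ≤ Real.pi / 2 * L := by
  have hpi := Real.pi_pos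
  rcases eq_or_ne (grad f x) 0 with h0 | h0
  · rw [h0, norm_zero]; positivity
  have hg := norm_pos_iff.2 h0
  set s : Tan x := (Real.pi / ‖grad f x‖) • grad f x with hs
  have hns : ‖s‖ = Real.pi := by
    rw [hs, norm_smul, Real.norm_of_nonneg (by positivity)]
    field_simp
  have hgs : ⟪grad f x, s⟫ = Real.pi * ‖grad f x‖ := by
    rw [hs, real_inner_smul_right, real_inner_self_eq_norm_sq]
    field_simp
  have hE : sphExp x (-s) = sphExp x s := by
    ext1
    simp [sphExp, expAmb, hns, Real.sinc_of_ne_zero hpi.ne']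
  have h1 := (abs_le.1 (hL.abs_sub_sub_le hf x s)).1
  have h2 := (abs_le.1 (hL.abs_sub_sub_le hf x (-s))).2
  rw [hE, inner_neg_right, norm_neg] at h2
  rw [hgs, hns] at h1 h2
  nlinarith

/-- Differentiate `⟪grad f(Exp(ts)), P_{ts} v⟫` at `t = 0`. The derivative of the transport is
normal to the sphere, so only the Hessian term survives, and the difference quotients are bounded by
hypothesis. -/
theorem HasLipschitzGradient.abs_inner_hess_le (hL : HasLipschitzGradient L f)
    (hf : TwiceDifferentiable f) (x : Sph n) (s v : Tan x) :
    |⟪hess f x s, v⟫| ≤ L * ‖s‖ * ‖v‖ := by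
  have hG : HasDerivAt (fun t : ℝ => (grad f (sphExp x (t • s)) : Amb n))
      (sphDeriv (fun y : Sph n => (grad f y : Amb n)) x s) 0 := by
    refine (hasFDerivAt_comp_of_coe (f := fun t : ℝ => sphExp x (t • s)) (y := x)
      (by simp [sphExp_zero]) (hf.mdifferentiable_grad x)
      (f' := ContinuousLinearMap.toSpanSingleton ℝ s) ?_).hasDerivAt |>.congr_deriv (by simp)
    refine (hasDerivAt_exp x s 0).hasFDerivAt.congr_fderiv ?_
    ext1
    simp
  have h0 : sphExp x ((0 : ℝ) • s) = x := by rw [zero_smul, sphExp_zero]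
  have hg0 : (grad f (sphExp x ((0 : ℝ) • s)) : Amb n) = grad f x :=
    congrArg (fun y => (grad f y : Amb n)) h0
  have hP0 : (transport x ((0 : ℝ) • s) v : Amb n) = v := by
    rw [coe_transport_smul]
    simp
  have hZ := (hG.inner ℝ (hasDerivAt_transport x s v 0)).congr_deriv
    (g' := ⟪hess f x s, v⟫) (by
      rw [hg0, hP0, h0, real_inner_smul_right, inner_tan_coe, mul_zero, zero_add, hess, connection,
        ContinuousLinearMap.comp_apply, proj,
        Submodule.inner_orthogonalProjectionOnto_eq_of_mem_right])
  rcases eq_or_ne s 0 with rfl | h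
  · simp
  have hL0 := hL.nonneg h
  have hb := hZ.hasFDerivAt.le_of_lip' (C := L * ‖s‖ * ‖v‖) (by positivity)
    (Filter.Eventually.of_forall fun t => by
      rw [hg0, hP0, sub_zero]
      refine (hL.abs_inner_sub_le x (t • s) v).trans_eq ?_
      rw [norm_smul]
      ring)
  simpa using hb

/-! ### The second differential of the exponential map -/

/-- The second differential of `Exp_x` at `s`, as a map to `ℝ^{n+1}`. -/
def expDeriv2 (x : Sph n) (s v w : Tan x) : Amb n :=
  (sincDerivCoeff ‖s‖ * ⟪s, w⟫) • (v : Amb n) +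
    (sincDerivCoeff ‖s‖ * ⟪w, v⟫
      - (Real.sinc ‖s‖ + 3 * sincDerivCoeff ‖s‖) / ‖s‖ ^ 2 * ⟪s, w⟫ * ⟪s, v⟫) • (s : Amb n) +
    (sincDerivCoeff ‖s‖ * ⟪s, v⟫) • (w : Amb n) -
    (sincDerivCoeff ‖s‖ * ⟪s, w⟫ * ⟪s, v⟫ + Real.sinc ‖s‖ * ⟪w, v⟫) • (x : Amb n)

theorem hasFDerivAt_inner_left {V : Type*} [NormedAddCommGroup V] [InnerProductSpace ℝ V] (s v : V) :
    HasFDerivAt (fun u : V => ⟪u, v⟫) (innerSL ℝ v) s := by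
  simpa only [real_inner_comm, innerSL_apply_apply] using! (innerSL ℝ v).hasFDerivAt (x := s)

theorem hasFDerivAt_sincDerivCoeff_smul (x : Sph n) (s v : Tan x) :
    ∃ D : Tan x →L[ℝ] Amb n,
      HasFDerivAt (fun u : Tan x => (sincDerivCoeff ‖u‖ * ⟪u, v⟫) • (u : Amb n)) D s ∧
      ∀ w, D w = (sincDerivCoeff ‖s‖ * ⟪w, v⟫
        - (Real.sinc ‖s‖ + 3 * sincDerivCoeff ‖s‖) / ‖s‖ ^ 2 * ⟪s, w⟫ * ⟪s, v⟫) • (s : Amb n) +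
        (sincDerivCoeff ‖s‖ * ⟪s, v⟫) • (w : Amb n) := by
  rcases eq_or_ne s 0 with rfl | h
  -- The coefficient is discontinuous at `0` but bounded, so the whole term is `O(‖u‖²)`.
  · refine ⟨0, ?_, fun w => by simp⟩
    refine Asymptotics.IsBigO.hasFDerivAt (n := 2) ?_ (by norm_num)
    refine Asymptotics.IsBigO.of_bound ‖v‖ (Filter.Eventually.of_forall fun u => ?_)
    have h1 := abs_sincDerivCoeff_le (norm_nonneg u)
    have h2 := abs_real_inner_le_norm u v
    rw [sub_zero, norm_smul, norm_mul, Real.norm_eq_abs, Real.norm_eq_abs, Submodule.coe_norm,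
      norm_pow, norm_norm]
    calc |sincDerivCoeff ‖u‖| * |⟪u, v⟫| * ‖u‖ ≤ 1 * (‖u‖ * ‖v‖) * ‖u‖ := by gcongr; linarith
      _ = ‖v‖ * ‖u‖ ^ 2 := by ring
  · have h1 := hasFDerivAt_comp_norm (hasDerivAt_sincDerivCoeff (norm_ne_zero_iff.2 h))
    refine ⟨_, (h1.mul (hasFDerivAt_inner_left s v)).smul (Tan x).subtypeL.hasFDerivAt, fun w => ?_⟩
    simp [real_inner_comm v w]
    module

theorem hasFDerivAt_expDeriv (x : Sph n) (s v : Tan x) :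
    ∃ D : Tan x →L[ℝ] Amb n, HasFDerivAt (fun u : Tan x => (expDeriv x u v : Amb n)) D s ∧
      ∀ w, D w = expDeriv2 x s v w := by
  obtain ⟨D, hD, hDw⟩ := hasFDerivAt_sincDerivCoeff_smul x s v
  have hs := hasFDerivAt_comp_norm (hasDerivAt_sinc ‖s‖)
  simp only [coe_expDeriv]
  refine ⟨_, ((hs.smul_const (v : Amb n)).add hD).sub
    ((hs.mul (hasFDerivAt_inner_left s v)).smul_const (x : Amb n)), fun w => ?_⟩
  simp [hDw, expDeriv2, real_inner_comm v w]
  module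

theorem mul_add_mul_le_of_sq {a b c d C D : ℝ} (hC : 0 ≤ C) (hD : 0 ≤ D)
    (h1 : a ^ 2 + b ^ 2 = C ^ 2) (h2 : c ^ 2 + d ^ 2 = D ^ 2) : a * c + b * d ≤ C * D := by
  refine abs_le_of_sq_le_sq' ?_ (by positivity) |>.2
  rw [mul_pow, ← h1, ← h2]
  nlinarith [sq_nonneg (a * d - b * c)]

/-- Split `v` and `w` along and across `s`. The along-along part vanishes, since radial geodesics
have normal acceleration; the across-across part pairs with the component of `g` along the
geodesic's velocity, the mixed parts with the component orthogonal to `x` and `s`. -/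
theorem inner_expDeriv2 (x : Sph n) {s : Tan x} (hs : s ≠ 0) (g : Tan (sphExp x s)) (v w : Tan x) :
    ⟪(g : Amb n), expDeriv2 x s v w⟫ =
      (‖s‖ - Real.sin ‖s‖ * Real.cos ‖s‖) / ‖s‖ ^ 2 *
        (Real.cos ‖s‖ * ⟪(g : Amb n), (s : Amb n)⟫ / ‖s‖ - Real.sin ‖s‖ * ⟪(g : Amb n), (x : Amb n)⟫) *
          (⟪v, w⟫ - ⟪s, v⟫ * ⟪s, w⟫ / ‖s‖ ^ 2) -
      (Real.sin ‖s‖ - ‖s‖ * Real.cos ‖s‖) / ‖s‖ ^ 2 *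
        (⟪s, w⟫ / ‖s‖ * (⟪(g : Amb n), (v : Amb n)⟫ - ⟪s, v⟫ * ⟪(g : Amb n), (s : Amb n)⟫ / ‖s‖ ^ 2) +
         ⟪s, v⟫ / ‖s‖ * (⟪(g : Amb n), (w : Amb n)⟫ - ⟪s, w⟫ * ⟪(g : Amb n), (s : Amb n)⟫ / ‖s‖ ^ 2)) := by
  have hr : ‖s‖ ≠ 0 := norm_ne_zero_iff.2 hs
  have hrel := inner_tan_coe _ g
  change ⟪(g : Amb n), expAmb x s⟫ = 0 at hrel
  rw [expAmb, inner_add_right, real_inner_smul_right, real_inner_smul_right,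
    Real.sinc_of_ne_zero hr] at hrel
  simp only [expDeriv2, inner_add_right, inner_sub_right, real_inner_smul_right, sincDerivCoeff,
    Real.sinc_of_ne_zero hr, real_inner_comm v w]
  have hsc := Real.sin_sq_add_cos_sq ‖s‖
  generalize ⟪(g : Amb n), (s : Amb n)⟫ = α at *
  generalize ⟪(g : Amb n), (x : Amb n)⟫ = β at *
  generalize ‖s‖ = r at *
  generalize Real.sin r = S at *
  generalize Real.cos r = C at *
  -- Tangency of `g` leaves one coordinate `p` in the plane of `x` and `s`, its component along the
  -- geodesic's unit velocity.
  obtain ⟨p, hp⟩ : ∃ p, p = C * α / r - S * β := ⟨_, rfl⟩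
  have hβ : β = -S * p := by
    rw [hp]
    field_simp at hrel ⊢
    linear_combination (-r * β) * hsc + C * hrel
  have hα : α = r * C * p := by
    rw [hp]
    field_simp at hrel ⊢
    linear_combination (-α) * hsc + S * hrel
  rw [← hp, hα, hβ]
  field_simp
  grind

/-- Rotating the frame `x, s/‖s‖` to the position and velocity at `Exp_x(s)` preserves length, and
the position component of a tangent vector is zero. -/
theorem sq_rotation_eq {S C r α β : ℝ} (hsc : S ^ 2 + C ^ 2 = 1) (h : C * β + S / r * α = 0) :
    (C * α / r - S * β) ^ 2 = (α / r) ^ 2 + β ^ 2 := by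
  linear_combination ((α / r) ^ 2 + β ^ 2) * hsc - (C * β + S / r * α) * h

theorem abs_inner_expDeriv2_le (x : Sph n) {s : Tan x} (hs : s ≠ 0) (g : Tan (sphExp x s)) :
    ∃ p q : ℝ, 0 ≤ p ∧ 0 ≤ q ∧ p ^ 2 + q ^ 2 = ‖g‖ ^ 2 ∧ ∀ v w : Tan x,
      |⟪(g : Amb n), expDeriv2 x s v w⟫| ≤
        ((‖s‖ - Real.sin ‖s‖ * Real.cos ‖s‖) / ‖s‖ ^ 2 * p +
          |Real.sin ‖s‖ - ‖s‖ * Real.cos ‖s‖| / ‖s‖ ^ 2 * q) * (‖v‖ * ‖w‖) := by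
  have hr : 0 < ‖s‖ := norm_pos_iff.2 hs
  have hrel := inner_tan_coe _ g
  change ⟪(g : Amb n), expAmb x s⟫ = 0 at hrel
  rw [expAmb, inner_add_right, real_inner_smul_right, real_inner_smul_right,
    Real.sinc_of_ne_zero hr.ne'] at hrel
  have hsc := Real.sin_sq_add_cos_sq ‖s‖
  set α := ⟪(g : Amb n), (s : Amb n)⟫ with hα
  set β := ⟪(g : Amb n), (x : Amb n)⟫ with hβ
  set p := Real.cos ‖s‖ * α / ‖s‖ - Real.sin ‖s‖ * β with hp
  set g' : Amb n := (g : Amb n) - β • (x : Amb n) - (α / ‖s‖ ^ 2) • (s : Amb n) with hg'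
  set o : Tan x → Tan x := fun v => v - (⟪s, v⟫ / ‖s‖ ^ 2) • s with ho
  have hoo : ∀ v w, ⟪o v, o w⟫ = ⟪v, w⟫ - ⟪s, v⟫ * ⟪s, w⟫ / ‖s‖ ^ 2 := by
    intro v w
    simp only [ho, inner_sub_left, inner_sub_right, real_inner_smul_left, real_inner_smul_right,
      real_inner_self_eq_norm_sq s, real_inner_comm s v]
    field_simp
    ring
  have hsq : ∀ v, (|⟪s, v⟫| / ‖s‖) ^ 2 + ‖o v‖ ^ 2 = ‖v‖ ^ 2 := by
    intro v
    rw [← real_inner_self_eq_norm_sq (o v), hoo, real_inner_self_eq_norm_sq, div_pow, sq_abs]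
    ring
  have hgo : ∀ v : Tan x, ⟪(g : Amb n), (v : Amb n)⟫ - ⟪s, v⟫ * α / ‖s‖ ^ 2 =
      ⟪g', (o v : Amb n)⟫ := by
    intro v
    have h1 : ⟪(s : Amb n), (v : Amb n)⟫ = ⟪s, v⟫ := rfl
    simp only [ho, hg', inner_sub_left, inner_sub_right, real_inner_smul_left,
      real_inner_smul_right, Submodule.coe_sub, Submodule.coe_smul, inner_coe_tan, h1,
      inner_tan_self, ← hα]
    field_simp
    ring
  have hpq : |p| ^ 2 + ‖g'‖ ^ 2 = ‖g‖ ^ 2 := by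
    rw [sq_abs, ← real_inner_self_eq_norm_sq g']
    simp only [hg', inner_sub_left, inner_sub_right, real_inner_smul_left, real_inner_smul_right,
      inner_coe_tan, inner_tan_coe, inner_tan_self, inner_coe_self,
      real_inner_comm (g : Amb n) (x : Amb n), real_inner_comm (g : Amb n) (s : Amb n), ← hα, ← hβ]
    rw [hp, sq_rotation_eq hsc hrel]
    field_simp
    ring
  have hgo' : ∀ v : Tan x, |⟪(g : Amb n), (v : Amb n)⟫ - ⟪s, v⟫ * α / ‖s‖ ^ 2| ≤ ‖g'‖ * ‖o v‖ := by
    intro v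
    rw [hgo]
    exact abs_real_inner_le_norm _ _
  have hole : ∀ v, ‖o v‖ ≤ ‖v‖ := fun v =>
    (sq_le_sq₀ (norm_nonneg _) (norm_nonneg _)).1 (by nlinarith [hsq v])
  refine ⟨|p|, ‖g'‖, abs_nonneg _, norm_nonneg _, hpq, fun v w => ?_⟩
  rw [inner_expDeriv2 x hs, ← hα, ← hβ, ← hp, ← hoo]
  have c0 : 0 ≤ (‖s‖ - Real.sin ‖s‖ * Real.cos ‖s‖) / ‖s‖ ^ 2 :=
    div_nonneg (sub_nonneg.2 (sin_mul_cos_le_self hr.le)) (by positivity)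
  have b1 : |⟪o v, o w⟫| ≤ ‖v‖ * ‖w‖ :=
    (abs_real_inner_le_norm _ _).trans
      (mul_le_mul (hole v) (hole w) (norm_nonneg _) (norm_nonneg _))
  -- Planar Cauchy–Schwarz for the along and across lengths of `v` and `w` avoids a factor `2` here.
  have b2 : |⟪s, w⟫ / ‖s‖ * (⟪(g : Amb n), (v : Amb n)⟫ - ⟪s, v⟫ * α / ‖s‖ ^ 2) +
      ⟪s, v⟫ / ‖s‖ * (⟪(g : Amb n), (w : Amb n)⟫ - ⟪s, w⟫ * α / ‖s‖ ^ 2)| ≤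
      ‖g'‖ * (‖v‖ * ‖w‖) := by
    have h := mul_add_mul_le_of_sq (norm_nonneg v) (norm_nonneg w)
      ((add_comm _ _).trans (hsq v)) (hsq w)
    refine (abs_add_le _ _).trans ?_
    rw [abs_mul, abs_mul, abs_div, abs_div, abs_norm]
    calc _ ≤ |⟪s, w⟫| / ‖s‖ * (‖g'‖ * ‖o v‖) + |⟪s, v⟫| / ‖s‖ * (‖g'‖ * ‖o w‖) := by
          gcongr <;> exact hgo' _
      _ = ‖g'‖ * (‖o v‖ * (|⟪s, w⟫| / ‖s‖) + |⟪s, v⟫| / ‖s‖ * ‖o w‖) := by ring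
      _ ≤ _ := by gcongr
  refine (abs_sub _ _).trans ?_
  rw [abs_mul, abs_mul, abs_mul, abs_of_nonneg c0, abs_div, abs_of_pos (pow_pos hr 2), add_mul,
    mul_assoc _ (‖g'‖)]
  gcongr

theorem abs_inner_expDeriv2_le_const (x : Sph n) {s : Tan x} (hs : s ≠ 0) (g : Tan (sphExp x s))
    (v w : Tan x) :
    |⟪(g : Amb n), expDeriv2 x s v w⟫| ≤ 3 / Real.pi * ‖g‖ * (‖v‖ * ‖w‖) := by
  have hr : 0 < ‖s‖ := norm_pos_iff.2 hs
  obtain ⟨p, q, hp, hq, hpq, h⟩ := abs_inner_expDeriv2_le x hs g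
  refine (h v w).trans (mul_le_mul_of_nonneg_right ?_ (by positivity))
  refine abs_le_of_sq_le_sq' ?_ (by positivity) |>.2
  have h1 := sq_add_sq_coeff_le hr
  rw [← sq_abs ((Real.sin ‖s‖ - ‖s‖ * Real.cos ‖s‖) / ‖s‖ ^ 2), abs_div,
    abs_of_pos (pow_pos hr 2)] at h1
  rw [mul_pow, ← hpq]
  refine le_trans ?_ (mul_le_mul_of_nonneg_right h1 (by positivity))
  generalize (‖s‖ - Real.sin ‖s‖ * Real.cos ‖s‖) / ‖s‖ ^ 2 = a
  generalize |Real.sin ‖s‖ - ‖s‖ * Real.cos ‖s‖| / ‖s‖ ^ 2 = b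
  nlinarith [sq_nonneg (a * q - b * p)]

theorem abs_inner_expDeriv2_le_norm (x : Sph n) {s : Tan x} (hs : s ≠ 0) (g : Tan (sphExp x s))
    (v w : Tan x) :
    |⟪(g : Amb n), expDeriv2 x s v w⟫| ≤ ‖s‖ * ‖g‖ * (‖v‖ * ‖w‖) := by
  have hr : 0 < ‖s‖ := norm_pos_iff.2 hs
  obtain ⟨p, q, hp, hq, hpq, h⟩ := abs_inner_expDeriv2_le x hs g
  refine (h v w).trans (mul_le_mul_of_nonneg_right ?_ (by positivity))
  have hpg : p ≤ ‖g‖ := (sq_le_sq₀ hp (norm_nonneg _)).1 (by nlinarith)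
  have hqg : q ≤ ‖g‖ := (sq_le_sq₀ hq (norm_nonneg _)).1 (by nlinarith)
  have h1 : (‖s‖ - Real.sin ‖s‖ * Real.cos ‖s‖) / ‖s‖ ^ 2 ≤ 2 / 3 * ‖s‖ := by
    rw [div_le_iff₀ (by positivity)]
    linarith [(abs_le.1 (abs_sub_sin_mul_cos_le hr.le)).2]
  have h2 : |Real.sin ‖s‖ - ‖s‖ * Real.cos ‖s‖| / ‖s‖ ^ 2 ≤ 1 / 3 * ‖s‖ := by
    rw [div_le_iff₀ (by positivity)]
    linarith [abs_sin_sub_mul_cos_le_cube hr.le]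
  calc _ ≤ 2 / 3 * ‖s‖ * ‖g‖ + 1 / 3 * ‖s‖ * ‖g‖ := by gcongr
    _ = _ := by ring

/-! ### The gradient and the Hessian of the pullback -/

/-- Testing against a fixed `v` avoids differentiating `expDeriv x u` as an operator, whose codomain
varies with `u`. -/
theorem differentiableAt_of_inner {V W : Type*} [NormedAddCommGroup V] [InnerProductSpace ℝ V]
    [FiniteDimensional ℝ V] [NormedAddCommGroup W] [NormedSpace ℝ W] {N : W → V} {s : W}
    (h : ∀ v, DifferentiableAt ℝ (fun u => ⟪N u, v⟫) s) : DifferentiableAt ℝ N s := by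
  have e : N = fun u => ∑ i, ⟪N u, stdOrthonormalBasis ℝ V i⟫ • stdOrthonormalBasis ℝ V i := by
    funext u
    conv_lhs => rw [← (stdOrthonormalBasis ℝ V).sum_repr' (N u)]
    simp only [real_inner_comm]
  rw [e]
  exact DifferentiableAt.fun_sum fun i _ => (h _).smul_const _

theorem inner_gradient_pullback (hf : MDifferentiable (𝓡 n) 𝓘(ℝ, ℝ) f) (x : Sph n) (s v : Tan x) :
    ⟪gradient (pullback f x) s, v⟫ = ⟪(grad f (sphExp x s) : Amb n), (expDeriv x s v : Amb n)⟫ := by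
  rw [inner_gradient_left]
  have h : fderiv ℝ (pullback f x) s = _ := (hasFDerivAt_comp_sphExp hf x s).fderiv
  rw [h]
  exact (inner_grad f _ _).symm

theorem inner_hess (f : Sph n → ℝ) (y : Sph n) (u v : Tan y) :
    ⟪hess f y u, v⟫ = ⟪sphDeriv (fun y : Sph n => (grad f y : Amb n)) y u, (v : Amb n)⟫ := by
  rw [hess, connection, ContinuousLinearMap.comp_apply, proj,
    Submodule.inner_orthogonalProjectionOnto_eq_of_mem_right]

theorem hasFDerivAt_inner_gradient_pullback (hf : TwiceDifferentiable f) (x : Sph n)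
    (s v : Tan x) :
    ∃ D : Tan x →L[ℝ] ℝ, HasFDerivAt (fun u => ⟪gradient (pullback f x) u, v⟫) D s ∧
      ∀ w, D w = ⟪(grad f (sphExp x s) : Amb n), expDeriv2 x s v w⟫ +
        ⟪hess f (sphExp x s) (expDeriv x s w), expDeriv x s v⟫ := by
  obtain ⟨D, hD, hDw⟩ := hasFDerivAt_expDeriv x s v
  simp only [inner_gradient_pullback hf.mdifferentiable]
  refine ⟨_, (hasFDerivAt_comp_sphExp hf.mdifferentiable_grad x s).inner ℝ hD, fun w => ?_⟩
  rw [inner_hess, ← hDw]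
  rfl

theorem differentiable_gradient_pullback (hf : TwiceDifferentiable f) (x : Sph n) :
    Differentiable ℝ (gradient (pullback f x)) := fun s =>
  differentiableAt_of_inner fun v =>
    (hasFDerivAt_inner_gradient_pullback hf x s v).choose_spec.1.differentiableAt

theorem inner_euclHess_pullback (hf : TwiceDifferentiable f) (x : Sph n) (s v w : Tan x) :
    ⟪euclHess (pullback f x) s w, v⟫ = ⟪(grad f (sphExp x s) : Amb n), expDeriv2 x s v w⟫ +
      ⟪hess f (sphExp x s) (expDeriv x s w), expDeriv x s v⟫ := by
  obtain ⟨D, hD, hDw⟩ := hasFDerivAt_inner_gradient_pullback hf x s v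
  rw [← hDw]
  have h := ((differentiable_gradient_pullback hf x s).hasFDerivAt.inner ℝ
    (hasFDerivAt_const v s)).unique hD
  rw [← h]
  simp [euclHess]

/-- At `0` the differential of `Exp_x` is the identity and its second differential `-⟪w, v⟫ x` is
normal, hence orthogonal to the gradient. -/
theorem euclHess_pullback_zero (hf : TwiceDifferentiable f) (x : Sph n) :
    euclHess (pullback f x) 0 = hess f x := by
  ext1 w
  refine ext_inner_right ℝ fun v => ?_
  have key : ∀ y : Sph n, y = x → ⟪(grad f y : Amb n), (x : Amb n)⟫ = 0 := by
    rintro y rfl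
    exact inner_tan_coe _ _
  have key2 : ∀ (y : Sph n) (a b : Tan y), y = x → (a : Amb n) = w → (b : Amb n) = v →
      ⟪hess f y a, b⟫ = ⟪hess f x w, v⟫ := by
    rintro y a b rfl ha hb
    rw [Subtype.ext ha, Subtype.ext hb]
  rw [inner_euclHess_pullback hf, key2 _ _ _ (sphExp_zero x) (by simp [coe_expDeriv])
    (by simp [coe_expDeriv])]
  simp only [expDeriv2, inner_zero_left, mul_zero, zero_smul, Submodule.coe_zero,
    smul_zero, zero_add, add_zero, zero_sub, inner_neg_right, real_inner_smul_right,
    key _ (sphExp_zero x), neg_zero]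

theorem opNorm_le_of_inner {V : Type*} [NormedAddCommGroup V] [InnerProductSpace ℝ V]
    {A : V →L[ℝ] V} {C : ℝ} (hC : 0 ≤ C) (h : ∀ v w, |⟪A w, v⟫| ≤ C * (‖v‖ * ‖w‖)) :
    ‖A‖ ≤ C := by
  refine A.opNorm_le_bound hC fun w => ?_
  rcases (norm_nonneg (A w)).eq_or_lt with h0 | h0
  · rw [← h0]
    positivity
  · have := (le_abs_self _).trans (h (A w) w)
    rw [real_inner_self_eq_norm_sq] at this
    nlinarith

theorem norm_euclHess_pullback_le (hf : TwiceDifferentiable f) (hL : HasLipschitzGradient L f)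
    (hL0 : 0 ≤ L) (x : Sph n) (s : Tan x) : ‖euclHess (pullback f x) s‖ ≤ 5 / 2 * L := by
  refine opNorm_le_of_inner (by positivity) fun v w => ?_
  rcases eq_or_ne s 0 with rfl | hs
  · rw [euclHess_pullback_zero hf]
    refine (hL.abs_inner_hess_le hf x w v).trans ?_
    have : 0 ≤ L * (‖v‖ * ‖w‖) := by positivity
    linarith
  have hpi := Real.pi_pos
  rw [inner_euclHess_pullback hf]
  refine (abs_add_le _ _).trans ?_
  have h1 := abs_inner_expDeriv2_le_const x hs (grad f (sphExp x s)) v w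
  have h2 := hL.norm_grad_le hL0 hf.mdifferentiable (sphExp x s)
  have h3 : 3 / Real.pi * ‖grad f (sphExp x s)‖ * (‖v‖ * ‖w‖) ≤ 3 / 2 * L * (‖v‖ * ‖w‖) := by
    calc _ ≤ 3 / Real.pi * (Real.pi / 2 * L) * (‖v‖ * ‖w‖) := by gcongr
      _ = _ := by field_simp
  have h4 : |⟪hess f (sphExp x s) (expDeriv x s w), expDeriv x s v⟫| ≤ L * (‖v‖ * ‖w‖) := by
    refine (hL.abs_inner_hess_le hf _ _ _).trans ?_
    calc _ ≤ L * ‖w‖ * ‖v‖ := by gcongr <;> exact norm_expDeriv_le _ _ _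
      _ = _ := by ring
  linarith

theorem norm_gradient_pullback_sub_le (hf : TwiceDifferentiable f)
    (hL : HasLipschitzGradient L f) (x : Sph n) (u v : Tan x) :
    ‖gradient (pullback f x) u - gradient (pullback f x) v‖ ≤ 5 / 2 * L * ‖u - v‖ := by
  -- Nonnegativity of `L` needs a nonzero tangent vector; for `n = 0` it can fail.
  rcases eq_or_ne u v with rfl | h
  · simp
  exact convex_univ.norm_image_sub_le_of_norm_fderiv_le (𝕜 := ℝ)
    (fun s _ => differentiable_gradient_pullback hf x s)
    (fun s _ => norm_euclHess_pullback_le hf hL (hL.nonneg (sub_ne_zero.2 h)) x s)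
    (Set.mem_univ v) (Set.mem_univ u)

theorem norm_euclHess_pullback_sub_le (hf : TwiceDifferentiable f)
    (hL : HasLipschitzGradient L f) {ρ : ℝ} (hρ : HasLipschitzHessian ρ f) (x : Sph n)
    (s : Tan x) :
    ‖euclHess (pullback f x) s - euclHess (pullback f x) 0‖ ≤ (ρ + 3.1 * L) * ‖s‖ := by
  rcases eq_or_ne s 0 with rfl | hs
  · simp only [sub_self, norm_zero, mul_zero]
    exact ContinuousLinearMap.opNorm_zero.le
  have hr : 0 < ‖s‖ := norm_pos_iff.2 hs
  have hL0 := hL.nonneg hs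
  have hρ0 : 0 ≤ ρ * ‖s‖ := (ContinuousLinearMap.opNorm_nonneg _).trans (hρ x s)
  rw [euclHess_pullback_zero hf]
  refine opNorm_le_of_inner (by rw [add_mul]; positivity) fun v w => ?_
  set M : Tan x → Tan x → ℝ := fun a b =>
    ⟪hess f (sphExp x s) (transport x s a), transport x s b⟫ with hM
  have hMle : ∀ a b, |M a b| ≤ L * ‖a‖ * ‖b‖ := fun a b => by
    have := hL.abs_inner_hess_le hf (sphExp x s) (transport x s a) (transport x s b)
    rwa [norm_transport, norm_transport] at this
  -- Telescoping from `M (R_s w) (R_s v)` to `M w v` replaces one `R_s` by the identity at a time;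
  -- each replacement costs `L‖s‖/2`, since `1 - sinc r ≤ r/2`.
  have e : ⟪(euclHess (pullback f x) s - hess f x) w, v⟫ =
      ⟪(grad f (sphExp x s) : Amb n), expDeriv2 x s v w⟫ + (M w v - ⟪hess f x w, v⟫) +
        (M (radialScaling s w - w) v + M (radialScaling s w) (radialScaling s v - v)) := by
    rw [sub_apply, inner_sub_left, inner_euclHess_pullback hf]
    simp only [hM, expDeriv, ContinuousLinearMap.comp_apply, map_sub, inner_sub_left,
      inner_sub_right]
    ring
  have h1 : |⟪(grad f (sphExp x s) : Amb n), expDeriv2 x s v w⟫| ≤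
      1.6 * L * ‖s‖ * (‖v‖ * ‖w‖) := by
    have h2 := hL.norm_grad_le hL0 hf.mdifferentiable (sphExp x s)
    have h3 : Real.pi / 2 ≤ 1.6 := by linarith [Real.pi_lt_d2]
    calc _ ≤ ‖s‖ * ‖grad f (sphExp x s)‖ * (‖v‖ * ‖w‖) := abs_inner_expDeriv2_le_norm x hs _ v w
      _ ≤ ‖s‖ * (1.6 * L) * (‖v‖ * ‖w‖) := by
        gcongr
        exact h2.trans (mul_le_mul_of_nonneg_right h3 hL0)
      _ = _ := by ring
  have h2 : |M w v - ⟪hess f x w, v⟫| ≤ ρ * ‖s‖ * (‖v‖ * ‖w‖) := by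
    have e2 : M w v - ⟪hess f x w, v⟫ = ⟪(ContinuousLinearMap.adjoint (transport x s) ∘L
        hess f (sphExp x s) ∘L transport x s - hess f x) w, v⟫ := by
      rw [sub_apply, inner_sub_left, ContinuousLinearMap.comp_apply,
        ContinuousLinearMap.adjoint_inner_left]
      rfl
    rw [e2]
    refine (abs_real_inner_le_norm _ _).trans ?_
    calc _ ≤ ρ * ‖s‖ * ‖w‖ * ‖v‖ := by
          gcongr
          exact ContinuousLinearMap.le_of_opNorm_le _ (hρ x s) w
      _ = _ := by ring
  have hsinc := one_sub_sinc_le hr.le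
  have h0 : ∀ a : Tan x, ‖radialScaling s a - a‖ ≤ ‖s‖ / 2 * ‖a‖ := fun a =>
    (norm_radialScaling_sub_le s a).trans (mul_le_mul_of_nonneg_right hsinc (norm_nonneg _))
  have h3 : |M (radialScaling s w - w) v| ≤ L * ‖s‖ / 2 * (‖v‖ * ‖w‖) := by
    refine (hMle _ _).trans ?_
    calc _ ≤ L * (‖s‖ / 2 * ‖w‖) * ‖v‖ := by gcongr; exact h0 w
      _ = _ := by ring
  have h4 : |M (radialScaling s w) (radialScaling s v - v)| ≤ L * ‖s‖ / 2 * (‖v‖ * ‖w‖) := by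
    refine (hMle _ _).trans ?_
    calc _ ≤ L * ‖w‖ * (‖s‖ / 2 * ‖v‖) := by
          gcongr
          · exact norm_radialScaling_le s w
          · exact h0 v
      _ = _ := by ring
  rw [e]
  refine (abs_add_three _ _ _).trans ?_
  have h5 := abs_add_le (M (radialScaling s w - w) v) (M (radialScaling s w) (radialScaling s v - v))
  have h6 : 0 ≤ L * ‖s‖ * (‖v‖ * ‖w‖) := by positivity
  -- The coefficients of `L` add up to `1.6 + 1/2 + 1/2 = 2.6`, below `3.1`.
  linarith

end SpherePullback

end

theorem mainTheorem8 (n : ℕ) (f : SpherePullback.Sph n → ℝ)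
    (hf : SpherePullback.TwiceDifferentiable f) (L : ℝ)
    (hL : SpherePullback.HasLipschitzGradient L f) :
    (∀ x : SpherePullback.Sph n,
      Differentiable ℝ (SpherePullback.pullback f x) ∧
      Differentiable ℝ (gradient (SpherePullback.pullback f x)) ∧
      ∀ u v : SpherePullback.Tan x,
        ‖gradient (SpherePullback.pullback f x) u - gradient (SpherePullback.pullback f x) v‖
          ≤ 5 / 2 * L * ‖u - v‖) ∧
    (∀ ρ : ℝ, SpherePullback.HasLipschitzHessian ρ f →
      ∀ (x : SpherePullback.Sph n) (s : SpherePullback.Tan x),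
        ‖SpherePullback.euclHess (SpherePullback.pullback f x) s
            - SpherePullback.euclHess (SpherePullback.pullback f x) 0‖
          ≤ (ρ + 3.1 * L) * ‖s‖) :=
  ⟨fun x =>
    ⟨fun s => (SpherePullback.hasFDerivAt_comp_sphExp hf.mdifferentiable x s).differentiableAt,
      SpherePullback.differentiable_gradient_pullback hf x,
      SpherePullback.norm_gradient_pullback_sub_le hf hL x⟩,
    fun _ hρ x s => SpherePullback.norm_euclHess_pullback_sub_le hf hL hρ x s⟩
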